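/- Let $H\in(0,1)$ and $\nu>0$. Let $B_H=(B_H(t))_{t\ge 0}$ be a fractional Brownian motion with Hurst exponent $H$, i.e. a centred Gaussian process with a.s. continuous paths and $$\mathrm{Cov}(B_H(s),B_H(t))=\tfrac12\left(s^{2H}+t^{2H}-|t-s|^{2H}\right),\qquad s,t\ge 0.$$ Let $U=(U(t))_{t\ge0}$ be a gamma process with parameter $\nu$, independent of $B_H$, i.e. a Lévy process (started at $0$, with independent increments and a.s. càdlàg paths) such that for all $t\ge0$, $h>0$ the increment $U(t+h)-U(t)$ has density $x^{h/\nu-1}e^{-x}/\Gamma(h/\nu)$ on $(0,\infty)$. Let $V(t)=\inf\{\tau\ge 0: U(\tau)>t\}$ be the first-exit (inverse) process of $U$, and let $Y_2(t)=B_H(V(t))$, $t\ge0$. Then $Y_2$ has long-range dependence, in the following sense: $Y_2(t)$ has finite variance for every $t\ge 0$, and there are $d\in(0,1)$ and, for every $s>0$, a constant $c(s)\neq 0$ such that for every fixed $s>0$ $$\mathrm{Corr}(Y_2(s),Y_2(t))\sim c(s)\,t^{-d}\qquad\text{as } t\to\infty.$$ The exponent $d$ does not depend on $s$. -/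

import Mathlib

open MeasureTheory ProbabilityTheory Filter Topology Asymptotics
open scoped NNReal

/-- `B` is a fractional Brownian motion with Hurst exponent `H`: a centred Gaussian process with
almost surely continuous paths and the standard covariance function. -/
structure IsFBM {Ω : Type*} [MeasurableSpace Ω] (H : ℝ) (B : ℝ≥0 → Ω → ℝ) (P : Measure Ω) :
    Prop where
  measurable : ∀ t, Measurable (B t)
  gaussian : IsGaussianProcess B P
  centered : ∀ t, ∫ ω, B t ω ∂P = 0
  covariance_eq : ∀ s t : ℝ≥0, cov[B s, B t; P] =
    ((s : ℝ) ^ (2 * H) + (t : ℝ) ^ (2 * H) - |(t : ℝ) - (s : ℝ)| ^ (2 * H)) / 2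
  continuous : ∀ᵐ ω ∂P, Continuous fun t => B t ω

/-- `U` is a gamma process with parameter `ν`: a Lévy process whose increments over intervals of
length `h > 0` have the gamma law with shape `h / ν` and scale `1`. -/
structure IsGammaProcess {Ω : Type*} [MeasurableSpace Ω] (ν : ℝ) (U : ℝ≥0 → Ω → ℝ)
    (P : Measure Ω) : Prop where
  measurable : ∀ t, Measurable (U t)
  zero : ∀ᵐ ω ∂P, U 0 ω = 0
  indep : HasIndepIncrements U P
  law : ∀ t h : ℝ≥0, 0 < h → HasLaw (fun ω => U (t + h) ω - U t ω) (gammaMeasure (h / ν) 1) P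
  cadlag : ∀ᵐ ω ∂P, ∀ t : ℝ≥0, ContinuousWithinAt (fun r => U r ω) (Set.Ici t) t ∧
    ∃ l : ℝ, Tendsto (fun r => U r ω) (𝓝[<] t) (𝓝 l)

/-- The first-exit time (inverse) process `V(t) = inf {τ ≥ 0 : U(τ) > t}`. The set is almost surely
nonempty for a gamma process; where it is empty the infimum is `0` by convention. -/
noncomputable def firstExit {Ω : Type*} (U : ℝ≥0 → Ω → ℝ) (t : ℝ≥0) (ω : Ω) : ℝ≥0 :=
  sInf {τ : ℝ≥0 | (t : ℝ) < U τ ω}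

/-- The time-changed process `t ↦ X(T(t))`. -/
def timeChange {Ω : Type*} (X : ℝ≥0 → Ω → ℝ) (T : ℝ≥0 → Ω → ℝ≥0) (t : ℝ≥0) (ω : Ω) : ℝ :=
  X (T t ω) ω

/-- The correlation coefficient. -/
noncomputable def corr {Ω : Type*} [MeasurableSpace Ω] (X Y : Ω → ℝ) (P : Measure Ω) : ℝ :=
  cov[X, Y; P] / (√(Var[X; P]) * √(Var[Y; P]))

/-- Long-range dependence of a (possibly non-stationary) finite-variance process: there is one
`d ∈ (0, 1)` such that for each fixed `s > 0`, `Corr(X(s), X(t)) ∼ c(s) t ^ (-d)` as `t → ∞`, with a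
nonzero constant `c(s)` depending only on `s`. -/
structure HasLRD {Ω : Type*} [MeasurableSpace Ω] (X : ℝ≥0 → Ω → ℝ) (P : Measure Ω) : Prop where
  memLp_two : ∀ t, MemLp (X t) 2 P
  corr_isEquivalent : ∃ d ∈ Set.Ioo (0 : ℝ) 1, ∃ c : ℝ≥0 → ℝ, ∀ s : ℝ≥0, 0 < s →
    c s ≠ 0 ∧ (fun t : ℝ≥0 => corr (X s) (X t) P) ~[atTop] fun t => c s * (t : ℝ) ^ (-d)

/-!
Condition on the random times. Since `B` is centred and independent of `T = firstExit U`, the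
covariance of `B (T s)` and `B (T t)` is the expectation of the fractional covariance function at
`(T s, T t)`; only second moments of `B` enter.

The strong law of large numbers gives `U t / t → m = E[U 1]`, hence `T t / t → 1 / m`. Since
`E[exp (-2 U 1)] < 1`, for small `δ > 0` the variables `exp (2 (δ n - U n))` have summable
expectations, so `n ↦ δ n - U n` is bounded by a square integrable random variable. Hence `T t / t`
is dominated by a square integrable random variable on `t ≥ 1`, and moments of order at most two
may be computed in the limit. Thus `E[(T t) ^ (2 H)] ~ (t / m) ^ (2 H)`. In the covariance the term
`(T s) ^ (2 H)` is constant in `t` while `(T t) ^ (2 H) - (T t - T s) ^ (2 H)` is of order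
`t ^ (2 H - 1)`, and both are nonnegative. Dividing by the standard deviations, the correlation
decays like `t ^ (-min H (1 - H))`.
-/

open scoped ENNReal

section FractionalCovariance

/-- The covariance function of fractional Brownian motion with Hurst exponent `H`. -/
noncomputable def fbmCov (H s t : ℝ) : ℝ := (s ^ (2 * H) + t ^ (2 * H) - |t - s| ^ (2 * H)) / 2

lemma fbmCov_self {H : ℝ} (hH : H ≠ 0) (t : ℝ) : fbmCov H t t = t ^ (2 * H) := by
  rw [fbmCov, sub_self, abs_zero, Real.zero_rpow (mul_ne_zero two_ne_zero hH), sub_zero,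
    add_self_div_two]

lemma measurable_fbmCov (H : ℝ) : Measurable fun p : ℝ × ℝ => fbmCov H p.1 p.2 := by
  unfold fbmCov
  fun_prop

/-- The limit of `fbmCov H a v / t ^ max (2 * H - 1) 0` when `v / t → μ`. The two terms, of order
`1` and `t ^ (2 * H - 1)` respectively, only balance for `H = 1 / 2`. -/
noncomputable def fbmCovLimit (H μ a : ℝ) : ℝ :=
  ((if 2 * H - 1 ≤ 0 then a ^ (2 * H) else 0) +
    if 0 ≤ 2 * H - 1 then 2 * H * μ ^ (2 * H - 1) * a else 0) / 2

lemma fbmCovLimit_pos {H μ a : ℝ} (hH : 0 < H) (hμ : 0 < μ) (ha : 0 < a) :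
    0 < fbmCovLimit H μ a := by
  unfold fbmCovLimit
  rcases le_total (2 * H - 1) 0 with h | h <;> simp only [h, if_true] <;> split_ifs <;> positivity

lemma tendsto_rpow_neg_max (x : ℝ) :
    Tendsto (fun t : ℝ≥0 => (t : ℝ) ^ (-max x 0)) atTop (𝓝 (if x ≤ 0 then 1 else 0)) := by
  split_ifs with hx
  · simp [max_eq_right hx]
  · rw [max_eq_left (not_le.1 hx).le]
    exact (tendsto_rpow_neg_atTop (not_le.1 hx)).comp (NNReal.tendsto_coe_atTop.2 tendsto_id)

lemma tendsto_rpow_sub_abs_rpow_div {v : ℝ≥0 → ℝ} {μ : ℝ} (hμ : 0 < μ)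
    (hv : Tendsto (fun t : ℝ≥0 => v t / t) atTop (𝓝 μ)) (p a : ℝ) :
    Tendsto (fun t : ℝ≥0 => (v t ^ p - |v t - a| ^ p) / (t : ℝ) ^ (p - 1)) atTop
      (𝓝 (p * μ ^ (p - 1) * a)) := by
  have hcoe : Tendsto (fun t : ℝ≥0 => (t : ℝ)) atTop atTop := NNReal.tendsto_coe_atTop.2 tendsto_id
  have hva : Tendsto (fun t : ℝ≥0 => (v t - a) / t) atTop (𝓝 μ) := by
    simpa only [sub_div, sub_zero] using hv.sub (tendsto_const_nhds.div_atTop hcoe)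
  have hderiv : (fun t : ℝ≥0 => (v t / t) ^ p - ((v t - a) / t) ^ p -
      p * μ ^ (p - 1) * (v t / t - (v t - a) / t)) =o[atTop]
      fun t : ℝ≥0 => v t / t - (v t - a) / t := by
    simpa [Function.comp_def, mul_comm] using
      (Real.hasStrictDerivAt_rpow_const (p := p) (Or.inl hμ.ne')).isLittleO.comp_tendsto
        (hv.prodMk_nhds hva)
  have hincr : (fun t : ℝ≥0 => v t / t - (v t - a) / t) =O[atTop] fun t : ℝ≥0 => (t : ℝ)⁻¹ := by
    refine ((isBigO_refl (fun t : ℝ≥0 => (t : ℝ)⁻¹) atTop).const_mul_left a).congr_left fun t => ?_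
    rw [← sub_div, sub_sub_cancel, div_eq_mul_inv]
  have hlim := (hderiv.trans_isBigO hincr).tendsto_div_nhds_zero.add_const (p * μ ^ (p - 1) * a)
  rw [zero_add] at hlim
  refine hlim.congr' ?_
  filter_upwards [hcoe.eventually_gt_atTop 0, hv.eventually_const_lt hμ,
    hva.eventually_const_lt hμ] with t ht hvt hvat
  have hvt' : 0 < v t := (div_pos_iff_of_pos_right ht).1 hvt
  have hvat' : 0 < v t - a := (div_pos_iff_of_pos_right ht).1 hvat
  rw [abs_of_pos hvat', Real.div_rpow hvt'.le ht.le, Real.div_rpow hvat'.le ht.le,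
    Real.rpow_sub_one ht.ne']
  field_simp
  ring

lemma tendsto_fbmCov_div {v : ℝ≥0 → ℝ} {μ : ℝ} (hμ : 0 < μ)
    (hv : Tendsto (fun t : ℝ≥0 => v t / t) atTop (𝓝 μ)) (H a : ℝ) :
    Tendsto (fun t : ℝ≥0 => fbmCov H a (v t) / (t : ℝ) ^ max (2 * H - 1) 0) atTop
      (𝓝 (fbmCovLimit H μ a)) := by
  have hconst := (tendsto_rpow_neg_max (2 * H - 1)).const_mul (a ^ (2 * H))
  have hincr := (tendsto_rpow_sub_abs_rpow_div hμ hv (2 * H) a).mul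
    (tendsto_rpow_neg_max (-(2 * H - 1)))
  have hlim := (hconst.add hincr).div_const 2
  simp only [mul_ite, mul_one, mul_zero, neg_nonpos] at hlim
  refine hlim.congr' ?_
  filter_upwards [eventually_gt_atTop 0] with t ht
  have ht' : (0 : ℝ) < t := ht
  have hexp : -max (-(2 * H - 1)) 0 = 2 * H - 1 - max (2 * H - 1) 0 := by
    linarith [max_zero_sub_max_neg_zero_eq_self (2 * H - 1)]
  rw [fbmCov, hexp, Real.rpow_sub ht' _ (max _ _), Real.rpow_neg ht'.le]
  field_simp
  ring

lemma rpow_sub_rpow_sub_le_of_one_le {a b p : ℝ} (ha : 0 ≤ a) (hab : a ≤ b) (hp : 1 ≤ p) :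
    b ^ p - (b - a) ^ p ≤ p * b ^ (p - 1) * a := by
  rcases (ha.trans hab).eq_or_lt with rfl | hb
  · simp [le_antisymm hab ha]
  have hratio : a / b ≤ 1 := (div_le_one hb).2 hab
  have hbernoulli : 1 + p * -(a / b) ≤ (1 + -(a / b)) ^ p :=
    one_add_mul_self_le_rpow_one_add (neg_le_neg hratio) hp
  have hfactor : (b - a) ^ p = b ^ p * (1 + -(a / b)) ^ p := by
    rw [← Real.mul_rpow hb.le (by linarith)]
    congr 1
    field_simp
    ring
  calc b ^ p - (b - a) ^ p ≤ b ^ p - b ^ p * (1 + p * -(a / b)) := by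
        rw [hfactor]
        gcongr
    _ = p * b ^ (p - 1) * a := by
        rw [Real.rpow_sub_one hb.ne']
        field_simp
        ring

lemma rpow_sub_rpow_sub_le_of_le_one {a b p : ℝ} (ha : 0 ≤ a) (hab : a ≤ b) (hp0 : 0 ≤ p)
    (hp : p ≤ 1) : b ^ p - (b - a) ^ p ≤ a ^ p := by
  have hadd := Real.rpow_add_le_add_rpow (sub_nonneg.2 hab) ha hp0 hp
  rw [sub_add_cancel] at hadd
  linarith

lemma fbmCov_nonneg {H a b : ℝ} (hH : 0 ≤ H) (ha : 0 ≤ a) (hab : a ≤ b) : 0 ≤ fbmCov H a b := by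
  have hmono : (b - a) ^ (2 * H) ≤ b ^ (2 * H) :=
    Real.rpow_le_rpow (sub_nonneg.2 hab) (sub_le_self b ha) (by positivity)
  rw [fbmCov, abs_of_nonneg (sub_nonneg.2 hab)]
  linarith [Real.rpow_nonneg ha (2 * H)]

lemma fbmCov_le_rpow {H a b : ℝ} (hH0 : 0 ≤ H) (hH : 2 * H ≤ 1) (ha : 0 ≤ a) (hab : a ≤ b) :
    fbmCov H a b ≤ a ^ (2 * H) := by
  rw [fbmCov, abs_of_nonneg (sub_nonneg.2 hab)]
  linarith [rpow_sub_rpow_sub_le_of_le_one ha hab (by positivity) hH]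

lemma fbmCov_le_mul_rpow {H a b : ℝ} (hH : 1 ≤ 2 * H) (ha : 0 ≤ a) (hab : a ≤ b) :
    fbmCov H a b ≤ 2 * H * (b ^ (2 * H - 1) * a) := by
  have hrpow : a ^ (2 * H) ≤ b ^ (2 * H - 1) * a := by
    rcases ha.eq_or_lt with rfl | ha
    · simp [Real.zero_rpow (by linarith : 2 * H ≠ 0)]
    · rw [← sub_add_cancel (2 * H) 1, Real.rpow_add_one ha.ne', add_sub_cancel_right]
      gcongr
  rw [fbmCov, abs_of_nonneg (sub_nonneg.2 hab)]
  nlinarith [rpow_sub_rpow_sub_le_of_one_le ha hab hH, Real.rpow_nonneg ha (2 * H)]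

lemma rpow_le_sq {x y p : ℝ} (hx : 0 ≤ x) (hxy : x ≤ y) (hy : 1 ≤ y) (hp0 : 0 ≤ p) (hp : p ≤ 2) :
    x ^ p ≤ y ^ 2 :=
  calc x ^ p ≤ y ^ p := Real.rpow_le_rpow hx hxy hp0
    _ ≤ y ^ (2 : ℝ) := Real.rpow_le_rpow_of_exponent_le hy hp
    _ = y ^ 2 := Real.rpow_two y

lemma fbmCov_div_le {H a b t y : ℝ} (hH0 : 0 ≤ H) (hH1 : H ≤ 1) (ha : 0 ≤ a) (hab : a ≤ b)
    (ht : 0 < t) (hy : 1 ≤ y) (hay : a ≤ y) (hby : b ≤ y * t) :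
    fbmCov H a b / t ^ max (2 * H - 1) 0 ≤ 2 * y ^ 2 := by
  rcases le_total (2 * H) 1 with hH | hH
  · rw [max_eq_right (by linarith), Real.rpow_zero, div_one]
    have hsq : a ^ (2 * H) ≤ y ^ 2 := rpow_le_sq ha hay hy (by positivity) (hH.trans one_le_two)
    linarith [fbmCov_le_rpow hH0 hH ha hab, sq_nonneg y]
  · have hb : 0 ≤ b := ha.trans hab
    rw [max_eq_left (by linarith), div_le_iff₀ (by positivity)]
    calc fbmCov H a b ≤ 2 * H * (b ^ (2 * H - 1) * a) := fbmCov_le_mul_rpow hH ha hab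
      _ ≤ 2 * 1 * ((y * t) ^ (2 * H - 1) * y) := by
        gcongr
      _ = 2 * y ^ (2 * H) * t ^ (2 * H - 1) := by
        rw [Real.mul_rpow (by linarith) ht.le, Real.rpow_sub_one (by linarith : y ≠ 0)]
        field_simp
      _ ≤ 2 * y ^ 2 * t ^ (2 * H - 1) := by
        gcongr
        exact rpow_le_sq (by linarith) le_rfl hy (by linarith) (by linarith)

end FractionalCovariance

section LinearGrowth

lemma integral_pos_of_ae_pos {α : Type*} [MeasurableSpace α] {μ : Measure α} [NeZero μ]
    {f : α → ℝ} (hf : Integrable f μ) (hpos : ∀ᵐ x ∂μ, 0 < f x) : 0 < ∫ x, f x ∂μ := by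
  have hnonneg : 0 ≤ᵐ[μ] f := hpos.mono fun _ => le_of_lt
  refine (integral_nonneg_of_ae hnonneg).lt_of_ne' fun h => ?_
  obtain ⟨x, hx, hx0⟩ := (hpos.and ((integral_eq_zero_iff_of_nonneg_ae hnonneg hf).1 h)).exists
  exact hx.ne' hx0

/-- A measurable, almost surely nondecreasing family of random times with `T t / t → μ` almost
surely, positive at positive times, and with a square integrable linear majorant: this
determines the growth of the moments of order at most two of `T t`. -/
structure HasLinearGrowth {Ω : Type*} [MeasurableSpace Ω] (T : ℝ≥0 → Ω → ℝ≥0) (μ : ℝ)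
    (P : Measure Ω) : Prop where
  aemeasurable : ∀ t, AEMeasurable (T t) P
  monotone : ∀ᵐ ω ∂P, Monotone fun t => T t ω
  pos : ∀ t, 0 < t → ∀ᵐ ω ∂P, 0 < T t ω
  rate_pos : 0 < μ
  tendsto : ∀ᵐ ω ∂P, Tendsto (fun t : ℝ≥0 => (T t ω : ℝ) / t) atTop (𝓝 μ)
  exists_le : ∃ D : Ω → ℝ, MemLp D 2 P ∧ ∀ᵐ ω ∂P, ∀ t : ℝ≥0, T t ω ≤ (1 + t) * D ω

namespace HasLinearGrowth

variable {Ω : Type*} [MeasurableSpace Ω] {P : Measure Ω} {T : ℝ≥0 → Ω → ℝ≥0} {μ : ℝ}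

lemma aemeasurable_coe (hT : HasLinearGrowth T μ P) (t : ℝ≥0) :
    AEMeasurable (fun ω => (T t ω : ℝ)) P :=
  measurable_coe_nnreal_real.comp_aemeasurable (hT.aemeasurable t)

lemma aemeasurable_fbmCov (hT : HasLinearGrowth T μ P) (H : ℝ) (s t : ℝ≥0) :
    AEMeasurable (fun ω => fbmCov H (T s ω) (T t ω)) P :=
  (measurable_fbmCov H).comp_aemeasurable (f := fun ω => ((T s ω : ℝ), (T t ω : ℝ)))
    ((hT.aemeasurable_coe s).prodMk (hT.aemeasurable_coe t))

lemma exists_memLp_le_mul [IsFiniteMeasure P] (hT : HasLinearGrowth T μ P) (s : ℝ≥0) :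
    ∃ Y : Ω → ℝ, MemLp Y 2 P ∧ (∀ ω, 1 ≤ Y ω) ∧
      ∀ᵐ ω ∂P, T s ω ≤ Y ω ∧ ∀ t : ℝ≥0, 1 ≤ t → T t ω ≤ Y ω * t := by
  obtain ⟨D, hD, hle⟩ := hT.exists_le
  have hs := s.coe_nonneg
  have hmem : MemLp (fun ω => (2 + s : ℝ) * (1 + |D ω|)) 2 P :=
    ((memLp_const (1 : ℝ)).add hD.abs).const_mul (2 + s : ℝ)
  refine ⟨fun ω => (2 + s) * (1 + |D ω|), hmem, fun ω => ?_, ?_⟩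
  · exact one_le_mul_of_one_le_of_one_le (by linarith) (le_add_of_nonneg_right (abs_nonneg _))
  filter_upwards [hle] with ω hω
  have hD_le : D ω ≤ 1 + |D ω| := (le_abs_self _).trans (le_add_of_nonneg_left zero_le_one)
  refine ⟨?_, fun t ht => ?_⟩
  · calc (T s ω : ℝ) ≤ (1 + s) * D ω := hω s
      _ ≤ (1 + s) * (1 + |D ω|) := by gcongr
      _ ≤ (2 + s) * (1 + |D ω|) := by gcongr; exact one_le_two
  · have hcoeff : 1 + (t : ℝ) ≤ (2 + s) * t := by
      linarith [mul_nonneg hs t.coe_nonneg, NNReal.one_le_coe.2 ht]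
    calc (T t ω : ℝ) ≤ (1 + t) * D ω := hω t
      _ ≤ (1 + t) * (1 + |D ω|) := by gcongr
      _ ≤ (2 + s) * t * (1 + |D ω|) := by gcongr
      _ = (2 + s) * (1 + |D ω|) * t := mul_right_comm _ _ _

variable [IsProbabilityMeasure P]

lemma integrable_rpow (hT : HasLinearGrowth T μ P) (t : ℝ≥0) {p : ℝ} (hp0 : 0 ≤ p) (hp : p ≤ 2) :
    Integrable (fun ω => (T t ω : ℝ) ^ p) P := by
  obtain ⟨Y, hY, hY1, hle⟩ := hT.exists_memLp_le_mul t
  refine hY.integrable_sq.mono' ((hT.aemeasurable_coe t).pow_const p).aestronglyMeasurable ?_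
  filter_upwards [hle] with ω hω
  rw [Real.norm_of_nonneg (by positivity)]
  exact rpow_le_sq (T t ω).coe_nonneg hω.1 (hY1 ω) hp0 hp

lemma integral_rpow_pos (hT : HasLinearGrowth T μ P) {t : ℝ≥0} (ht : 0 < t) {p : ℝ} (hp0 : 0 ≤ p)
    (hp : p ≤ 2) : 0 < ∫ ω, (T t ω : ℝ) ^ p ∂P := by
  refine integral_pos_of_ae_pos (hT.integrable_rpow t hp0 hp) ?_
  filter_upwards [hT.pos t ht] with ω hω using Real.rpow_pos_of_pos hω p

lemma tendsto_integral_rpow_div (hT : HasLinearGrowth T μ P) {p : ℝ} (hp0 : 0 ≤ p) (hp : p ≤ 2) :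
    Tendsto (fun t : ℝ≥0 => (∫ ω, (T t ω : ℝ) ^ p ∂P) / (t : ℝ) ^ p) atTop (𝓝 (μ ^ p)) := by
  obtain ⟨Y, hY, hY1, hle⟩ := hT.exists_memLp_le_mul 0
  have hlim : Tendsto (fun t : ℝ≥0 => ∫ ω, (T t ω : ℝ) ^ p / (t : ℝ) ^ p ∂P) atTop
      (𝓝 (∫ _, μ ^ p ∂P)) := by
    refine tendsto_integral_filter_of_dominated_convergence (fun ω => Y ω ^ 2)
      (.of_forall fun t =>
        (((hT.aemeasurable_coe t).pow_const p).div_const _).aestronglyMeasurable)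
      ?_ hY.integrable_sq ?_
    · filter_upwards [eventually_ge_atTop 1] with t ht
      filter_upwards [hle] with ω hω
      rw [Real.norm_of_nonneg (by positivity), ← Real.div_rpow (T t ω).coe_nonneg t.coe_nonneg]
      exact rpow_le_sq (by positivity) (div_le_of_le_mul₀ t.coe_nonneg
        (zero_le_one.trans (hY1 ω)) (hω.2 t ht)) (hY1 ω) hp0 hp
    · filter_upwards [hT.tendsto] with ω hω
      exact (hω.rpow_const (Or.inl hT.rate_pos.ne')).congr fun t =>
        Real.div_rpow (T t ω).coe_nonneg t.coe_nonneg p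
  simpa only [integral_div, integral_const, probReal_univ, one_smul] using hlim

variable {H : ℝ}

lemma tendsto_integral_fbmCov_div (hT : HasLinearGrowth T μ P) (hH : H ∈ Set.Icc 0 1) (s : ℝ≥0) :
    Tendsto (fun t : ℝ≥0 =>
      (∫ ω, fbmCov H (T s ω) (T t ω) ∂P) / (t : ℝ) ^ max (2 * H - 1) 0) atTop
      (𝓝 (∫ ω, fbmCovLimit H μ (T s ω) ∂P)) := by
  obtain ⟨Y, hY, hY1, hle⟩ := hT.exists_memLp_le_mul s
  simp only [← integral_div]
  refine tendsto_integral_filter_of_dominated_convergence (fun ω => 2 * Y ω ^ 2)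
    (.of_forall fun t => ((hT.aemeasurable_fbmCov H s t).div_const _).aestronglyMeasurable)
    ?_ (hY.integrable_sq.const_mul 2) ?_
  · filter_upwards [eventually_ge_atTop 1, eventually_ge_atTop s] with t ht hst
    filter_upwards [hT.monotone, hle] with ω hmono hω
    have hTs : (0 : ℝ) ≤ T s ω := (T s ω).coe_nonneg
    have hTst : (T s ω : ℝ) ≤ T t ω := hmono hst
    rw [Real.norm_of_nonneg (div_nonneg (fbmCov_nonneg hH.1 hTs hTst) (by positivity))]
    exact fbmCov_div_le hH.1 hH.2 hTs hTst (zero_lt_one.trans_le ht) (hY1 ω) hω.1 (hω.2 t ht)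
  · filter_upwards [hT.tendsto] with ω hω
    exact tendsto_fbmCov_div hT.rate_pos hω H (T s ω)

lemma integral_fbmCovLimit_pos (hT : HasLinearGrowth T μ P) (hH : H ∈ Set.Ioc 0 1) {s : ℝ≥0}
    (hs : 0 < s) : 0 < ∫ ω, fbmCovLimit H μ (T s ω) ∂P := by
  have hrpow := hT.integrable_rpow s (p := 2 * H) (by linarith [hH.1]) (by linarith [hH.2])
  have hid : Integrable (fun ω => (T s ω : ℝ)) P := by
    simpa only [Real.rpow_one] using hT.integrable_rpow s zero_le_one one_le_two
  have hint : Integrable (fun ω => fbmCovLimit H μ (T s ω)) P := by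
    unfold fbmCovLimit
    split_ifs <;> fun_prop
  refine integral_pos_of_ae_pos hint ?_
  filter_upwards [hT.pos s hs] with ω hω using fbmCovLimit_pos hH.1 hT.rate_pos hω

end HasLinearGrowth

end LinearGrowth

section RightContinuous

/-- Right continuity at every point: the half of the càdlàg condition by which a path is determined
by its values on a dense set of times. -/
def IsRightContinuous {α β : Type*} [Preorder α] [TopologicalSpace α] [TopologicalSpace β]
    (f : α → β) : Prop :=
  ∀ t, ContinuousWithinAt f (Set.Ici t) t

namespace IsRightContinuous

section Order

variable {α β : Type*} [LinearOrder α] [DenselyOrdered α] [TopologicalSpace α] [OrderTopology α]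
  [TopologicalSpace β] {f : α → β} {s : Set α}

lemma exists_mem_Ioo_of_dense (hf : IsRightContinuous f) (hs : Dense s) {t b : α} (htb : t < b)
    {u : Set β} (hu : u ∈ 𝓝 (f t)) : ∃ q ∈ s, q ∈ Set.Ioo t b ∧ f q ∈ u := by
  obtain ⟨c, hc, hcu⟩ := (mem_nhdsGE_iff_exists_Ico_subset' htb).1 (hf t hu)
  obtain ⟨q, hq, hqs⟩ :=
    hs.inter_open_nonempty _ isOpen_Ioo (Set.nonempty_Ioo.2 (lt_min htb hc))
  exact ⟨q, hqs, ⟨hq.1, hq.2.trans_le (min_le_left _ _)⟩,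
    hcu ⟨hq.1.le, hq.2.trans_le (min_le_right _ _)⟩⟩

lemma monotone_of_monotoneOn_dense [NoMaxOrder α] [LinearOrder β] [OrderTopology β]
    (hf : IsRightContinuous f) (hs : Dense s) (hmono : MonotoneOn f s) : Monotone f := by
  intro x y hxy
  rcases hxy.eq_or_lt with rfl | hlt
  · exact le_rfl
  by_contra! hfyx
  obtain ⟨u, v, hu, hv, hyu, hxv, huv⟩ := order_separated hfyx
  obtain ⟨b, hyb⟩ := exists_gt y
  obtain ⟨p, hps, hp, hpv⟩ := hf.exists_mem_Ioo_of_dense hs hlt (hv.mem_nhds hxv)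
  obtain ⟨q, hqs, hq, hqu⟩ := hf.exists_mem_Ioo_of_dense hs hyb (hu.mem_nhds hyu)
  exact (huv _ hqu _ hpv).not_ge (hmono hps hqs (hp.2.trans hq.1).le)

end Order

lemma exists_measurable_eval : ∃ e : (ℝ≥0 → ℝ) × ℝ≥0 → ℝ,
    Measurable e ∧ ∀ w, IsRightContinuous w → ∀ τ, e (w, τ) = w τ := by
  -- The grid points `⌈τ n⌉ / n` approach `τ` from the right.
  let grid (τ : ℝ≥0) (n : ℕ) : ℝ≥0 := ⌈(τ : ℝ) * n⌉₊ / n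
  refine ⟨fun p => limsup (fun n => p.1 (grid p.2 n)) atTop, Measurable.limsup fun n => ?_,
    fun w hw τ => Tendsto.limsup_eq ?_⟩
  · have hev : Measurable fun p : (ℝ≥0 → ℝ) × ℕ => p.1 (p.2 / n) :=
      measurable_from_prod_countable_left fun k => measurable_pi_apply ((k : ℝ≥0) / n)
    exact hev.comp (measurable_fst.prodMk (Nat.measurable_ceil.comp
      ((measurable_coe_nnreal_real.comp measurable_snd).mul_const _)))
  · have hgrid : Tendsto (grid τ) atTop (𝓝 τ) := by
      rw [← NNReal.tendsto_coe]
      simpa [grid, Function.comp_def] using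
        (tendsto_nat_ceil_mul_div_atTop τ.2).comp tendsto_natCast_atTop_atTop
    refine (hw τ).tendsto.comp (tendsto_nhdsWithin_iff.2 ⟨hgrid, ?_⟩)
    filter_upwards [eventually_gt_atTop 0] with n hn
    have hn' : (0 : ℝ) < n := by exact_mod_cast hn
    rw [Set.mem_Ici, ← NNReal.coe_le_coe]
    simpa [grid, le_div_iff₀ hn'] using Nat.le_ceil _

end IsRightContinuous

end RightContinuous

section RandomTime

section Fubini

variable {Ω E F : Type*} [MeasurableSpace Ω] [MeasurableSpace E] [MeasurableSpace F]
  {P : Measure Ω} [IsFiniteMeasure P] {X : Ω → E} {S : Ω → F}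

lemma lintegral_prodMk_of_indepFun (hXS : IndepFun X S P) (hX : AEMeasurable X P)
    (hS : AEMeasurable S P) {f : E × F → ℝ≥0∞} (hf : Measurable f) :
    ∫⁻ ω, f (X ω, S ω) ∂P = ∫⁻ ω, ∫⁻ ω', f (X ω', S ω) ∂P ∂P := by
  rw [← lintegral_map' hf.aemeasurable (hX.prodMk hS), hXS.map_prod_eq_prod_map_map hX hS,
    lintegral_prod_symm _ hf.aemeasurable, lintegral_map' hf.lintegral_prod_left'.aemeasurable hS]
  exact lintegral_congr fun ω => lintegral_map' (by fun_prop) hX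

lemma integral_prodMk_of_indepFun {G : Type*} [NormedAddCommGroup G] [NormedSpace ℝ G]
    (hXS : IndepFun X S P) (hX : AEMeasurable X P) (hS : AEMeasurable S P) {f : E × F → G}
    (hf : StronglyMeasurable f) (hint : Integrable (fun ω => f (X ω, S ω)) P) :
    ∫ ω, f (X ω, S ω) ∂P = ∫ ω, ∫ ω', f (X ω', S ω) ∂P ∂P := by
  have hmap := hXS.map_prod_eq_prod_map_map hX hS
  have hint' : Integrable f ((P.map X).prod (P.map S)) := by
    rw [← hmap]
    exact (integrable_map_measure hf.aestronglyMeasurable (hX.prodMk hS)).2 hint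
  rw [← integral_map (hX.prodMk hS) hf.aestronglyMeasurable, hmap, integral_prod_symm _ hint',
    integral_map hS hf.integral_prod_left'.aestronglyMeasurable]
  exact integral_congr_ae (.of_forall fun ω =>
    integral_map hX (hf.comp_measurable measurable_prodMk_right).aestronglyMeasurable)

end Fubini

/-- A centred process of finite variance with almost surely right-continuous paths: the
processes whose values at an independent random time have computable first and second moments. -/
structure IsCenteredSecondOrder {Ω : Type*} [MeasurableSpace Ω] (X : ℝ≥0 → Ω → ℝ)
    (P : Measure Ω) : Prop where
  measurable : ∀ t, Measurable (X t)
  memLp_two : ∀ t, MemLp (X t) 2 P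
  integral_eq_zero : ∀ t, ∫ ω, X t ω ∂P = 0
  rightContinuous : ∀ᵐ ω ∂P, IsRightContinuous fun t => X t ω

namespace IsCenteredSecondOrder

variable {Ω : Type*} [MeasurableSpace Ω] {P : Measure Ω} {X : ℝ≥0 → Ω → ℝ} {S T : Ω → ℝ≥0}

lemma measurable_path (hX : IsCenteredSecondOrder X P) : Measurable fun ω t => X t ω :=
  measurable_pi_iff.2 hX.measurable

lemma exists_measurable_eval (hX : IsCenteredSecondOrder X P) :
    ∃ e : (ℝ≥0 → ℝ) × ℝ≥0 → ℝ, Measurable e ∧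
      ∀ᵐ ω ∂P, ∀ τ, e (fun t => X t ω, τ) = X τ ω := by
  obtain ⟨e, he, heval⟩ := IsRightContinuous.exists_measurable_eval
  exact ⟨e, he, hX.rightContinuous.mono fun ω hω => heval _ hω⟩

lemma covariance_eq_integral_mul (hX : IsCenteredSecondOrder X P) (s t : ℝ≥0) :
    cov[X s, X t; P] = ∫ ω, X s ω * X t ω ∂P := by
  simp only [covariance, hX.integral_eq_zero, sub_zero]

variable [IsFiniteMeasure P]

lemma integral_comp_randomTime (hX : IsCenteredSecondOrder X P) (hS : AEMeasurable S P)
    (hT : AEMeasurable T P) (hind : IndepFun (fun ω t => X t ω) (fun ω => (S ω, T ω)) P)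
    {g : ℝ → ℝ → ℝ} (hg : Measurable g.uncurry)
    (hint : Integrable (fun ω => g (X (S ω) ω) (X (T ω) ω)) P) :
    ∫ ω, g (X (S ω) ω) (X (T ω) ω) ∂P =
      ∫ ω, ∫ ω', g (X (S ω) ω') (X (T ω) ω') ∂P ∂P := by
  obtain ⟨e, he, heval⟩ := hX.exists_measurable_eval
  have hmeas : Measurable fun p : (ℝ≥0 → ℝ) × ℝ≥0 × ℝ≥0 => g (e (p.1, p.2.1)) (e (p.1, p.2.2)) :=
    hg.comp (by fun_prop : Measurable fun p : (ℝ≥0 → ℝ) × ℝ≥0 × ℝ≥0 =>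
      (e (p.1, p.2.1), e (p.1, p.2.2)))
  have heq : (fun ω => g (e (fun t => X t ω, S ω)) (e (fun t => X t ω, T ω))) =ᵐ[P]
      fun ω => g (X (S ω) ω) (X (T ω) ω) := by
    filter_upwards [heval] with ω hω
    rw [hω, hω]
  calc ∫ ω, g (X (S ω) ω) (X (T ω) ω) ∂P
      = ∫ ω, g (e (fun t => X t ω, S ω)) (e (fun t => X t ω, T ω)) ∂P :=
        integral_congr_ae heq.symm
    _ = ∫ ω, ∫ ω', g (e (fun t => X t ω', S ω)) (e (fun t => X t ω', T ω)) ∂P ∂P :=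
        integral_prodMk_of_indepFun hind hX.measurable_path.aemeasurable (hS.prodMk hT)
          hmeas.stronglyMeasurable (hint.congr heq.symm)
    _ = ∫ ω, ∫ ω', g (X (S ω) ω') (X (T ω) ω') ∂P ∂P := by
        refine integral_congr_ae (.of_forall fun ω => integral_congr_ae ?_)
        filter_upwards [heval] with ω' hω'
        simp only [hω']

lemma memLp_two_comp_randomTime (hX : IsCenteredSecondOrder X P) (hS : AEMeasurable S P)
    (hind : IndepFun (fun ω t => X t ω) S P) (hint : Integrable (fun ω => Var[X (S ω); P]) P) :
    MemLp (fun ω => X (S ω) ω) 2 P := by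
  obtain ⟨e, he, heval⟩ := hX.exists_measurable_eval
  have heq : (fun ω => e (fun t => X t ω, S ω)) =ᵐ[P] fun ω => X (S ω) ω :=
    heval.mono fun ω hω => hω _
  have hpath := hX.measurable_path.aemeasurable (μ := P)
  refine MemLp.ae_eq heq ⟨(he.comp_aemeasurable (hpath.prodMk hS)).aestronglyMeasurable, ?_⟩
  rw [eLpNorm_lt_top_iff_lintegral_rpow_enorm_lt_top two_ne_zero ENNReal.ofNat_ne_top]
  simp only [ENNReal.toReal_ofNat, ENNReal.rpow_two]
  calc ∫⁻ ω, ‖e (fun t => X t ω, S ω)‖ₑ ^ 2 ∂P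
      = ∫⁻ ω, ∫⁻ ω', ‖e (fun t => X t ω', S ω)‖ₑ ^ 2 ∂P ∂P :=
        lintegral_prodMk_of_indepFun hind hpath hS (f := fun p => ‖e p‖ₑ ^ 2) (by fun_prop)
    _ = ∫⁻ ω, ENNReal.ofReal Var[X (S ω); P] ∂P := by
        refine lintegral_congr fun ω => ?_
        rw [ofReal_variance (hX.memLp_two _), evariance]
        simp only [hX.integral_eq_zero, sub_zero]
        exact lintegral_congr_ae (heval.mono fun ω' hω' => by simp only [hω'])
    _ < ∞ := hint.lintegral_lt_top

lemma integral_comp_randomTime_eq_zero (hX : IsCenteredSecondOrder X P) (hS : AEMeasurable S P)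
    (hind : IndepFun (fun ω t => X t ω) S P) (hint : Integrable (fun ω => X (S ω) ω) P) :
    ∫ ω, X (S ω) ω ∂P = 0 := by
  have hpair : IndepFun (fun ω t => X t ω) (fun ω => (S ω, S ω)) P :=
    hind.comp measurable_id (measurable_id.prodMk measurable_id)
  rw [hX.integral_comp_randomTime hS hS hpair (g := fun x _ => x) measurable_fst hint]
  simp only [hX.integral_eq_zero, integral_zero]

lemma covariance_comp_randomTime (hX : IsCenteredSecondOrder X P) (hS : AEMeasurable S P)
    (hT : AEMeasurable T P) (hind : IndepFun (fun ω t => X t ω) (fun ω => (S ω, T ω)) P)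
    (hSint : Integrable (fun ω => Var[X (S ω); P]) P)
    (hTint : Integrable (fun ω => Var[X (T ω); P]) P) :
    cov[fun ω => X (S ω) ω, fun ω => X (T ω) ω; P] = ∫ ω, cov[X (S ω), X (T ω); P] ∂P := by
  have hindS : IndepFun (fun ω t => X t ω) S P := hind.comp measurable_id measurable_fst
  have hindT : IndepFun (fun ω t => X t ω) T P := hind.comp measurable_id measurable_snd
  have hXS := hX.memLp_two_comp_randomTime hS hindS hSint
  have hXT := hX.memLp_two_comp_randomTime hT hindT hTint
  simp only [hX.covariance_eq_integral_mul]
  rw [covariance, hX.integral_comp_randomTime_eq_zero hS hindS (hXS.integrable one_le_two),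
    hX.integral_comp_randomTime_eq_zero hT hindT (hXT.integrable one_le_two)]
  simp only [sub_zero]
  exact hX.integral_comp_randomTime hS hT hind measurable_mul (hXS.integrable_mul hXT)

end IsCenteredSecondOrder

end RandomTime

section TimeChange

lemma isEquivalent_const_mul_rpow {f : ℝ≥0 → ℝ} {c p : ℝ} (hc : c ≠ 0)
    (hf : Tendsto (fun t : ℝ≥0 => f t / (t : ℝ) ^ p) atTop (𝓝 c)) :
    f ~[atTop] fun t => c * (t : ℝ) ^ p := by
  refine isEquivalent_of_tendsto_one ?_
  have hone := hf.div_const c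
  rw [div_self hc] at hone
  refine hone.congr fun t => ?_
  rw [Pi.div_apply, div_div, mul_comm]

lemma tendsto_sqrt_div_rpow {f : ℝ≥0 → ℝ} {a p : ℝ}
    (hf : Tendsto (fun t : ℝ≥0 => f t / (t : ℝ) ^ (2 * p)) atTop (𝓝 a)) :
    Tendsto (fun t : ℝ≥0 => √(f t) / (t : ℝ) ^ p) atTop (𝓝 √a) := by
  refine hf.sqrt.congr fun t => ?_
  rw [Real.sqrt_div' _ (by positivity), mul_comm, Real.rpow_mul t.coe_nonneg, Real.rpow_two,
    Real.sqrt_sq (by positivity)]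

/-- A centred second-order process with the covariance function of fractional Brownian motion:
long-range dependence is a second-order property, so this is the relevant part of `IsFBM`. -/
structure IsFractionalProcess {Ω : Type*} [MeasurableSpace Ω] (H : ℝ) (B : ℝ≥0 → Ω → ℝ)
    (P : Measure Ω) : Prop extends IsCenteredSecondOrder B P where
  covariance_eq : ∀ s t : ℝ≥0, cov[B s, B t; P] = fbmCov H s t

variable {Ω : Type*} [MeasurableSpace Ω] {P : Measure Ω} {H μ : ℝ} {B : ℝ≥0 → Ω → ℝ}
  {T : ℝ≥0 → Ω → ℝ≥0}

lemma IsFBM.isFractionalProcess (hB : IsFBM H B P) : IsFractionalProcess H B P where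
  measurable := hB.measurable
  memLp_two t := (hB.gaussian.hasGaussianLaw_eval t).memLp_two
  integral_eq_zero := hB.centered
  rightContinuous := hB.continuous.mono fun _ hω _ => hω.continuousWithinAt
  covariance_eq := hB.covariance_eq

namespace IsFractionalProcess

lemma variance_eq (hB : IsFractionalProcess H B P) (hH : H ≠ 0) (t : ℝ≥0) :
    Var[B t; P] = (t : ℝ) ^ (2 * H) := by
  rw [← covariance_self (hB.measurable t).aemeasurable, hB.covariance_eq, fbmCov_self hH]

variable [IsProbabilityMeasure P]

lemma integrable_variance (hB : IsFractionalProcess H B P) (hT : HasLinearGrowth T μ P)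
    (hH : H ∈ Set.Ioc 0 1) (t : ℝ≥0) : Integrable (fun ω => Var[B (T t ω); P]) P := by
  simp only [hB.variance_eq hH.1.ne']
  exact hT.integrable_rpow t (by linarith [hH.1]) (by linarith [hH.2])

lemma memLp_two_timeChange (hB : IsFractionalProcess H B P) (hT : HasLinearGrowth T μ P)
    (hind : IndepFun (fun ω t => B t ω) (fun ω t => T t ω) P) (hH : H ∈ Set.Ioc 0 1) (t : ℝ≥0) :
    MemLp (timeChange B T t) 2 P :=
  hB.memLp_two_comp_randomTime (hT.aemeasurable t)
    (hind.comp measurable_id (measurable_pi_apply t)) (hB.integrable_variance hT hH t)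

lemma covariance_timeChange (hB : IsFractionalProcess H B P) (hT : HasLinearGrowth T μ P)
    (hind : IndepFun (fun ω t => B t ω) (fun ω t => T t ω) P) (hH : H ∈ Set.Ioc 0 1) (s t : ℝ≥0) :
    cov[timeChange B T s, timeChange B T t; P] = ∫ ω, fbmCov H (T s ω) (T t ω) ∂P := by
  have hpair : IndepFun (fun ω t => B t ω) (fun ω => (T s ω, T t ω)) P :=
    hind.comp measurable_id ((measurable_pi_apply s).prodMk (measurable_pi_apply t))
  simp only [← hB.covariance_eq]
  exact hB.covariance_comp_randomTime (hT.aemeasurable s) (hT.aemeasurable t) hpair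
    (hB.integrable_variance hT hH s) (hB.integrable_variance hT hH t)

lemma variance_timeChange (hB : IsFractionalProcess H B P) (hT : HasLinearGrowth T μ P)
    (hind : IndepFun (fun ω t => B t ω) (fun ω t => T t ω) P) (hH : H ∈ Set.Ioc 0 1) (t : ℝ≥0) :
    Var[timeChange B T t; P] = ∫ ω, (T t ω : ℝ) ^ (2 * H) ∂P := by
  rw [← covariance_self (hB.memLp_two_timeChange hT hind hH t).aestronglyMeasurable.aemeasurable,
    hB.covariance_timeChange hT hind hH]
  simp only [fbmCov_self hH.1.ne']

/-- The covariance grows like `t ^ max (2 * H - 1) 0` and the standard deviation like `t ^ H`, so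
that the exponent of long-range dependence is `H - max (2 * H - 1) 0 = min (1 - H) H`. -/
theorem hasLRD_timeChange (hB : IsFractionalProcess H B P) (hT : HasLinearGrowth T μ P)
    (hind : IndepFun (fun ω t => B t ω) (fun ω t => T t ω) P) (hH : H ∈ Set.Ioo 0 1) :
    HasLRD (timeChange B T) P := by
  have hH' := Set.Ioo_subset_Ioc_self hH
  refine ⟨hB.memLp_two_timeChange hT hind hH', H - max (2 * H - 1) 0, ?_, fun s =>
    (∫ ω, fbmCovLimit H μ (T s ω) ∂P) / (√(∫ ω, (T s ω : ℝ) ^ (2 * H) ∂P) * √(μ ^ (2 * H))),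
    fun s hs => ?_⟩
  · rcases max_cases (2 * H - 1) 0 with ⟨hmax, -⟩ | ⟨hmax, -⟩ <;> rw [hmax] <;>
      constructor <;> linarith [hH.1, hH.2]
  have hp0 : 0 ≤ 2 * H := by linarith [hH.1]
  have hp2 : 2 * H ≤ 2 := by linarith [hH.2]
  have hcov_pos := hT.integral_fbmCovLimit_pos hH' hs
  have hsd_pos : 0 < √(∫ ω, (T s ω : ℝ) ^ (2 * H) ∂P) :=
    Real.sqrt_pos.2 (hT.integral_rpow_pos hs hp0 hp2)
  have hrate_pos : 0 < √(μ ^ (2 * H)) := Real.sqrt_pos.2 (Real.rpow_pos_of_pos hT.rate_pos _)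
  have hc := (div_pos hcov_pos (mul_pos hsd_pos hrate_pos)).ne'
  refine ⟨hc, isEquivalent_const_mul_rpow hc ?_⟩
  have hcov := hT.tendsto_integral_fbmCov_div (Set.Ioc_subset_Icc_self hH') s
  have hsd := tendsto_sqrt_div_rpow (hT.tendsto_integral_rpow_div hp0 hp2)
  refine (hcov.div (hsd.const_mul _) (mul_pos hsd_pos hrate_pos).ne').congr' ?_
  filter_upwards [eventually_gt_atTop 0] with t ht
  have ht' : (0 : ℝ) < t := ht
  rw [Pi.div_apply, corr, hB.covariance_timeChange hT hind hH',
    hB.variance_timeChange hT hind hH', hB.variance_timeChange hT hind hH', neg_sub,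
    Real.rpow_sub ht']
  field_simp

end IsFractionalProcess

end TimeChange

section ExitTime

lemma tendsto_div_trans {ι : Type*} {l : Filter ι} {a b c : ι → ℝ} {x y : ℝ}
    (hab : Tendsto (fun i => a i / b i) l (𝓝 x)) (hbc : Tendsto (fun i => b i / c i) l (𝓝 y))
    (hy : y ≠ 0) : Tendsto (fun i => a i / c i) l (𝓝 (x * y)) := by
  refine (hab.mul hbc).congr' ?_
  filter_upwards [hbc.eventually_ne hy] with i hi
  exact div_mul_div_cancel₀ (left_ne_zero_of_mul hi)

lemma tendsto_div_atTop_of_monotone_of_nat {f : ℝ≥0 → ℝ} (hf : Monotone f) {m : ℝ}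
    (hlim : Tendsto (fun n : ℕ => f n / n) atTop (𝓝 m)) :
    Tendsto (fun t : ℝ≥0 => f t / t) atTop (𝓝 m) := by
  have hcoe : Tendsto (fun t : ℝ≥0 => (t : ℝ)) atTop atTop := NNReal.tendsto_coe_atTop.2 tendsto_id
  have hfloor : Tendsto (fun t : ℝ≥0 => ⌊(t : ℝ)⌋₊) atTop atTop :=
    tendsto_nat_floor_atTop.comp hcoe
  have hratio : Tendsto (fun t : ℝ≥0 => (⌊(t : ℝ)⌋₊ : ℝ) / t) atTop (𝓝 1) :=
    tendsto_nat_floor_div_atTop.comp hcoe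
  have hratio' : Tendsto (fun t : ℝ≥0 => ((⌊(t : ℝ)⌋₊ + 1 : ℕ) : ℝ) / t) atTop (𝓝 1) := by
    simpa [add_div] using hratio.add (tendsto_inv_atTop_zero.comp hcoe)
  have hlower : Tendsto (fun t : ℝ≥0 => f (⌊(t : ℝ)⌋₊ : ℕ) / t) atTop (𝓝 m) := by
    simpa using tendsto_div_trans (hlim.comp hfloor) hratio one_ne_zero
  have hupper : Tendsto (fun t : ℝ≥0 => f (⌊(t : ℝ)⌋₊ + 1 : ℕ) / t) atTop (𝓝 m) := by
    simpa using
      tendsto_div_trans (hlim.comp ((tendsto_add_atTop_nat 1).comp hfloor)) hratio' one_ne_zero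
  refine tendsto_of_tendsto_of_tendsto_of_le_of_le hlower hupper (fun t => ?_) fun t => ?_
  · refine div_le_div_of_nonneg_right (hf ?_) t.2
    exact_mod_cast Nat.floor_le t.2
  · refine div_le_div_of_nonneg_right (hf ?_) t.2
    exact_mod_cast (Nat.lt_floor_add_one (t : ℝ)).le

lemma tendsto_atTop_of_tendsto_div {f : ℝ≥0 → ℝ} {m : ℝ} (hm : 0 < m)
    (hlim : Tendsto (fun t : ℝ≥0 => f t / t) atTop (𝓝 m)) : Tendsto f atTop atTop := by
  refine (hlim.pos_mul_atTop hm (NNReal.tendsto_coe_atTop.2 tendsto_id)).congr' ?_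
  filter_upwards [eventually_gt_atTop 0] with t ht
  exact div_mul_cancel₀ _ (NNReal.coe_ne_zero.2 ht.ne')

lemma tendsto_comp_div_of_abs_sub_le_one {ι : Type*} {l : Filter ι} {f : ℝ≥0 → ℝ} {m : ℝ}
    (hlim : Tendsto (fun t : ℝ≥0 => f t / t) atTop (𝓝 m)) {v w : ι → ℝ≥0} (hv : Tendsto v l atTop)
    (hwv : ∀ᶠ i in l, |(w i : ℝ) - v i| ≤ 1) : Tendsto (fun i => f (w i) / v i) l (𝓝 m) := by
  have hv' : Tendsto (fun i => (v i : ℝ)) l atTop := NNReal.tendsto_coe_atTop.2 hv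
  have hw : Tendsto w l atTop := by
    refine NNReal.tendsto_coe_atTop.1 (tendsto_atTop_mono' l ?_ (tendsto_atTop_add_const_right l
      (-1) hv'))
    filter_upwards [hwv] with i hi
    linarith [neg_le_of_abs_le hi]
  have hratio : Tendsto (fun i => (w i : ℝ) / v i) l (𝓝 1) := by
    refine tendsto_iff_norm_sub_tendsto_zero.2 (squeeze_zero' (Eventually.of_forall fun _ =>
      norm_nonneg _) ?_ (tendsto_inv_atTop_zero.comp hv'))
    filter_upwards [hwv, hv'.eventually_gt_atTop 0] with i hi hpos
    rw [div_sub_one hpos.ne', norm_div, Real.norm_eq_abs, Real.norm_of_nonneg hpos.le,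
      Function.comp_apply, inv_eq_one_div]
    exact div_le_div_of_nonneg_right hi hpos.le
  simpa using tendsto_div_trans (hlim.comp hw) hratio one_ne_zero

/-- The first time at which a path exceeds the level `t`: `firstExit` for a single path, with the
same convention `sInf ∅ = 0` for a level that is never exceeded. -/
noncomputable def exitTime (f : ℝ≥0 → ℝ) (t : ℝ≥0) : ℝ≥0 := sInf {τ : ℝ≥0 | (t : ℝ) < f τ}

variable {f : ℝ≥0 → ℝ}

lemma exitTime_le {t τ : ℝ≥0} (h : t < f τ) : exitTime f t ≤ τ :=
  csInf_le (OrderBot.bddBelow _) h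

lemma le_of_lt_exitTime {t τ : ℝ≥0} (h : τ < exitTime f t) : f τ ≤ t :=
  not_lt.1 fun h' => (exitTime_le h').not_gt h

lemma nonempty_setOf_lt_of_tendsto_atTop (hf : Tendsto f atTop atTop) (t : ℝ≥0) :
    {τ : ℝ≥0 | (t : ℝ) < f τ}.Nonempty :=
  (hf.eventually_gt_atTop (t : ℝ)).exists

lemma lt_of_exitTime_lt (hmono : Monotone f) (hf : Tendsto f atTop atTop) {t τ : ℝ≥0}
    (h : exitTime f t < τ) : t < f τ := by
  obtain ⟨x, hx, hxτ⟩ := exists_lt_of_csInf_lt (nonempty_setOf_lt_of_tendsto_atTop hf t) h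
  exact lt_of_lt_of_le hx (hmono hxτ.le)

lemma monotone_exitTime (hf : Tendsto f atTop atTop) : Monotone (exitTime f) := fun _ t hst =>
  csInf_le_csInf (OrderBot.bddBelow _) (nonempty_setOf_lt_of_tendsto_atTop hf t) fun _ hτ =>
    (NNReal.coe_le_coe.2 hst).trans_lt hτ

lemma exitTime_le_of_forall_mul_le_add {δ w : ℝ} (hδ : 0 < δ) (hw : 0 ≤ w)
    (h : ∀ n : ℕ, δ * n ≤ f n + w) (t : ℝ≥0) : exitTime f t ≤ 1 + (t + w) / δ := by
  rcases eq_zero_or_pos (exitTime f t) with h0 | hpos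
  · rw [h0, NNReal.coe_zero]
    positivity
  · obtain ⟨n, hn⟩ := Nat.exists_eq_succ_of_ne_zero (Nat.ceil_pos.2 hpos).ne'
    have hfn : f n ≤ t := le_of_lt_exitTime (Nat.lt_ceil.1 (hn ▸ n.lt_succ_self))
    have hle : (exitTime f t : ℝ) ≤ n + 1 := by exact_mod_cast hn ▸ Nat.le_ceil (exitTime f t)
    have hn_le : (n : ℝ) ≤ (t + w) / δ := by
      rw [le_div_iff₀' hδ]
      linarith [h n]
    linarith

lemma exitTime_pos (hf : Tendsto f atTop atTop) (hright : IsRightContinuous f) (hf0 : f 0 = 0)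
    {t : ℝ≥0} (ht : 0 < t) : 0 < exitTime f t := by
  have hnhds : f ⁻¹' Set.Iio (t : ℝ) ∈ 𝓝[≥] (0 : ℝ≥0) :=
    hright 0 (Iio_mem_nhds (hf0 ▸ NNReal.coe_pos.2 ht))
  obtain ⟨c, hc, hcf⟩ := (mem_nhdsGE_iff_exists_Ico_subset' one_pos).1 hnhds
  refine lt_of_lt_of_le hc (le_csInf (nonempty_setOf_lt_of_tendsto_atTop hf t) fun τ hτ => ?_)
  by_contra! h
  exact lt_asymm (show f τ < t from hcf ⟨zero_le, h⟩) hτ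

lemma tendsto_exitTime_atTop (hmono : Monotone f) (hf : Tendsto f atTop atTop) :
    Tendsto (exitTime f) atTop atTop := by
  refine tendsto_atTop.2 fun N => ?_
  filter_upwards [eventually_ge_atTop (Real.toNNReal (f N))] with t ht
  by_contra! h
  exact (lt_of_exitTime_lt hmono hf h).not_ge (Real.toNNReal_le_iff_le_coe.1 ht)

lemma tendsto_exitTime_div (hmono : Monotone f) {m : ℝ} (hm : 0 < m)
    (hlim : Tendsto (fun t : ℝ≥0 => f t / t) atTop (𝓝 m)) :
    Tendsto (fun t : ℝ≥0 => (exitTime f t : ℝ) / t) atTop (𝓝 m⁻¹) := by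
  have hf := tendsto_atTop_of_tendsto_div hm hlim
  have hV := tendsto_exitTime_atTop hmono hf
  have hlower : Tendsto (fun t => f (exitTime f t - 1) / exitTime f t) atTop (𝓝 m) := by
    refine tendsto_comp_div_of_abs_sub_le_one hlim hV ?_
    filter_upwards [hV.eventually_ge_atTop 1] with t ht
    simp [NNReal.coe_sub ht]
  have hupper : Tendsto (fun t => f (exitTime f t + 1) / exitTime f t) atTop (𝓝 m) :=
    tendsto_comp_div_of_abs_sub_le_one hlim hV (Eventually.of_forall fun t => by simp)
  have hmid : Tendsto (fun t : ℝ≥0 => (t : ℝ) / exitTime f t) atTop (𝓝 m) := by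
    refine tendsto_of_tendsto_of_tendsto_of_le_of_le' hlower hupper ?_ (Eventually.of_forall ?_)
    · filter_upwards [hV.eventually_gt_atTop 0] with t ht
      exact div_le_div_of_nonneg_right
        (le_of_lt_exitTime (tsub_lt_self ht one_pos)) (exitTime f t).2
    · exact fun t => div_le_div_of_nonneg_right
        (lt_of_exitTime_lt hmono hf (lt_add_one _)).le (exitTime f t).2
  exact (hmid.inv₀ hm.ne').congr fun t => inv_div _ _

lemma exitTime_eq_sInf_dense (hf : IsRightContinuous f) {s : Set ℝ≥0} (hs : Dense s) (t : ℝ≥0) :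
    exitTime f t = sInf {τ ∈ s | (t : ℝ) < f τ} := by
  have hdense : ∀ τ, t < f τ → ∀ b, τ < b → ∃ q ∈ {τ ∈ s | (t : ℝ) < f τ}, q < b := by
    intro τ hτ b hb
    obtain ⟨q, hqs, hq, hqt⟩ := hf.exists_mem_Ioo_of_dense hs hb (Ioi_mem_nhds hτ)
    exact ⟨q, ⟨hqs, hqt⟩, hq.2⟩
  rcases Set.eq_empty_or_nonempty {τ : ℝ≥0 | (t : ℝ) < f τ} with hempty | ⟨τ, hτ⟩
  · rw [exitTime, hempty, Set.subset_eq_empty (Set.sep_subset_ofPred s _) hempty]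
  · obtain ⟨q, hq, -⟩ := hdense τ hτ (τ + 1) (lt_add_one τ)
    refine le_antisymm (csInf_le_csInf (OrderBot.bddBelow _) ⟨q, hq⟩ fun _ h => h.2)
      (le_csInf ⟨τ, hτ⟩ fun x hx => le_of_forall_gt fun b hb => ?_)
    obtain ⟨r, hr, hrb⟩ := hdense x hx b hb
    exact (csInf_le (OrderBot.bddBelow _) hr).trans_lt hrb

lemma exists_measurable_exitTime : ∃ V : (ℝ≥0 → ℝ) → ℝ≥0 → ℝ≥0,
    Measurable V ∧ ∀ f, IsRightContinuous f → V f = exitTime f := by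
  obtain ⟨s, hs, hsd⟩ := TopologicalSpace.exists_countable_dense ℝ≥0
  refine ⟨fun f t => (⨅ q ∈ s, ⨅ _ : (t : ℝ) < f q, (q : ℝ≥0∞)).toNNReal, ?_, fun f hf => ?_⟩
  · refine measurable_pi_iff.2 fun t => ENNReal.measurable_toNNReal.comp
      (Measurable.biInf s hs fun q _ => ?_)
    simp only [iInf_eq_if]
    exact Measurable.ite (measurableSet_lt measurable_const (measurable_pi_apply q))
      measurable_const measurable_const
  · ext1 t
    have hsep : ⨅ q ∈ s, ⨅ _ : (t : ℝ) < f q, (q : ℝ≥0∞) =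
        ⨅ q ∈ {q ∈ s | (t : ℝ) < f q}, (q : ℝ≥0∞) := by
      simp only [Set.mem_ofPred_eq, iInf_and]
    rw [exitTime_eq_sInf_dense hf hsd]
    refine (congrArg ENNReal.toNNReal hsep).trans ?_
    rcases Set.eq_empty_or_nonempty {q ∈ s | (t : ℝ) < f q} with hempty | hne
    · rw [hempty, NNReal.sInf_empty, iInf_emptyset, ENNReal.toNNReal_top]
    · rw [← ENNReal.coe_sInf hne, ENNReal.toNNReal_coe]

end ExitTime

section RandomBounds

variable {Ω : Type*} [MeasurableSpace Ω] {P : Measure Ω}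

lemma exists_integrable_norm_le_of_summable_integral_norm {ι E : Type*} [Countable ι]
    [NormedAddCommGroup E] {F : ι → Ω → E} (hF : ∀ i, Integrable (F i) P)
    (hsum : Summable fun i => ∫ ω, ‖F i ω‖ ∂P) :
    ∃ W : Ω → ℝ, Integrable W P ∧ ∀ᵐ ω ∂P, ∀ i, ‖F i ω‖ ≤ W ω := by
  have haem : AEMeasurable (fun ω => ∑' i, ‖F i ω‖ₑ) P :=
    AEMeasurable.tsum fun i => (hF i).aestronglyMeasurable.enorm
  have hfinite : ∫⁻ ω, ∑' i, ‖F i ω‖ₑ ∂P ≠ ∞ := by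
    rw [lintegral_tsum fun i => (hF i).aestronglyMeasurable.enorm]
    simp_rw [← ofReal_integral_norm_eq_lintegral_enorm (hF _)]
    exact hsum.tsum_ofReal_ne_top
  refine ⟨fun ω => (∑' i, ‖F i ω‖ₑ).toReal, integrable_toReal_of_lintegral_ne_top haem hfinite, ?_⟩
  filter_upwards [ae_lt_top' haem hfinite] with ω hω i
  rw [← toReal_enorm]
  exact ENNReal.toReal_mono hω.ne (ENNReal.le_tsum i)

lemma exists_memLp_two_forall_mul_le_add {S : ℕ → Ω → ℝ} {q : ℝ} (hq : q < 1)
    (hint : ∀ n, Integrable (fun ω => Real.exp (-2 * S n ω)) P)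
    (hmgf : ∀ n, mgf (S n) P (-2) ≤ q ^ n) :
    ∃ δ > 0, ∃ W : Ω → ℝ, MemLp W 2 P ∧ 0 ≤ W ∧ ∀ᵐ ω ∂P, ∀ n : ℕ, δ * n ≤ S n ω + W ω := by
  have hq0 : 0 ≤ q := by simpa using mgf_nonneg.trans (hmgf 1)
  obtain ⟨δ, hδq, hδ⟩ : ∃ δ : ℝ, Real.exp (2 * δ) * q < 1 ∧ 0 < δ := by
    have hcont : ContinuousAt (fun δ : ℝ => Real.exp (2 * δ) * q) 0 := by fun_prop
    have hnhds : ∀ᶠ δ : ℝ in 𝓝 0, Real.exp (2 * δ) * q < 1 :=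
      hcont.eventually_lt_const (by simpa using hq)
    exact ((hnhds.filter_mono nhdsWithin_le_nhds).and self_mem_nhdsWithin :
      ∀ᶠ δ : ℝ in 𝓝[>] 0, _).exists
  have hexp : ∀ (n : ℕ) ω, Real.exp (2 * (δ * n - S n ω)) =
      Real.exp (2 * δ) ^ n * Real.exp (-2 * S n ω) := fun n ω => by
    rw [← Real.exp_nat_mul, ← Real.exp_add]
    ring_nf
  have hsum : Summable fun n : ℕ => ∫ ω, ‖Real.exp (2 * (δ * n - S n ω))‖ ∂P := by
    refine Summable.of_nonneg_of_le (fun n => integral_nonneg fun ω => norm_nonneg _) (fun n => ?_)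
      (summable_geometric_of_lt_one (by positivity) hδq)
    simp_rw [Real.norm_of_nonneg (Real.exp_pos _).le, hexp, integral_const_mul]
    rw [mul_pow]
    exact mul_le_mul_of_nonneg_left (hmgf n) (by positivity)
  obtain ⟨W, hW, hle⟩ := exists_integrable_norm_le_of_summable_integral_norm
    (fun n => by simpa only [hexp] using (hint n).const_mul (Real.exp (2 * δ) ^ n)) hsum
  refine ⟨δ, hδ, fun ω => √|W ω|, ?_, fun ω => Real.sqrt_nonneg _, ?_⟩
  · have haem : AEMeasurable (fun ω => √|W ω|) P :=
      hW.abs.aestronglyMeasurable.aemeasurable.sqrt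
    rw [memLp_two_iff_integrable_sq haem.aestronglyMeasurable]
    simpa only [Real.sq_sqrt (abs_nonneg _)] using hW.abs
  · filter_upwards [hle] with ω hω n
    have hsq : Real.exp (δ * n - S n ω) ≤ √|W ω| := by
      refine Real.le_sqrt_of_sq_le (le_trans (le_of_eq ?_) ((hω n).trans (le_abs_self _)))
      rw [Real.norm_of_nonneg (Real.exp_pos _).le, ← Real.exp_nat_mul, Nat.cast_ofNat]
    linarith [Real.add_one_le_exp (δ * n - S n ω)]

lemma integrable_exp_mul_of_nonpos_of_nonneg [IsFiniteMeasure P] {X : Ω → ℝ}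
    (hX : AEMeasurable X P) (hX0 : 0 ≤ᵐ[P] X) {c : ℝ} (hc : c ≤ 0) :
    Integrable (fun ω => Real.exp (c * X ω)) P := by
  simpa using integrable_exp_mul_of_le (-c) 0 (neg_nonneg.2 hc) hX.neg
    (by filter_upwards [hX0] with ω hω using neg_nonpos.2 hω)

lemma mgf_lt_one_of_nonneg [IsProbabilityMeasure P] {X : Ω → ℝ} (hX : AEMeasurable X P)
    (hX0 : 0 ≤ᵐ[P] X) (hX1 : ¬ X =ᵐ[P] 0) {c : ℝ} (hc : c < 0) : mgf X P c < 1 := by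
  have hint := integrable_exp_mul_of_nonpos_of_nonneg hX hX0 hc.le
  have hnonneg : 0 ≤ᵐ[P] fun ω => 1 - Real.exp (c * X ω) := by
    filter_upwards [hX0] with ω hω
    simpa using mul_nonpos_of_nonpos_of_nonneg hc.le hω
  have hpos : 0 < ∫ ω, (1 - Real.exp (c * X ω)) ∂P := by
    refine (integral_nonneg_of_ae hnonneg).lt_of_ne' fun h => hX1 ?_
    rw [integral_eq_zero_iff_of_nonneg_ae hnonneg ((integrable_const 1).sub hint)] at h
    filter_upwards [h] with ω hω
    simpa [sub_eq_zero, eq_comm (a := (1 : ℝ)), hc.ne] using hω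
  rw [integral_sub (integrable_const 1) hint] at hpos
  simpa [mgf] using hpos

end RandomBounds

section Subordinator

/-- A subordinator: a process started at `0` with stationary independent increments and almost
surely nondecreasing right-continuous paths. -/
structure IsSubordinator {Ω : Type*} [MeasurableSpace Ω] (U : ℝ≥0 → Ω → ℝ) (P : Measure Ω) :
    Prop where
  measurable : ∀ t, Measurable (U t)
  zero : ∀ᵐ ω ∂P, U 0 ω = 0
  indep : HasIndepIncrements U P
  identDistrib : ∀ t h, IdentDistrib (fun ω => U (t + h) ω - U t ω) (U h) P P
  monotone : ∀ᵐ ω ∂P, Monotone fun t => U t ω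
  rightContinuous : ∀ᵐ ω ∂P, IsRightContinuous fun t => U t ω

namespace IsSubordinator

variable {Ω : Type*} [MeasurableSpace Ω] {P : Measure Ω} {U : ℝ≥0 → Ω → ℝ}

lemma measurable_path (hU : IsSubordinator U P) : Measurable fun ω t => U t ω :=
  measurable_pi_iff.2 hU.measurable

lemma nonneg (hU : IsSubordinator U P) (t : ℝ≥0) : 0 ≤ᵐ[P] U t := by
  filter_upwards [hU.zero, hU.monotone] with ω h0 hmono
  exact h0.symm.trans_le (hmono zero_le)

lemma identDistrib_increment (hU : IsSubordinator U P) (n : ℕ) :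
    IdentDistrib (fun ω => U (n + 1 : ℕ) ω - U n ω) (U 1) P P := by
  simpa only [Nat.cast_add, Nat.cast_one] using hU.identDistrib n 1

lemma ae_sum_increment (hU : IsSubordinator U P) :
    ∀ᵐ ω ∂P, ∀ n : ℕ, ∑ i ∈ Finset.range n, (U (i + 1 : ℕ) ω - U i ω) = U n ω := by
  filter_upwards [hU.zero] with ω h0 n
  rw [Finset.sum_range_sub (fun i : ℕ => U i ω), Nat.cast_zero, h0, sub_zero]

lemma mgf_natCast (hU : IsSubordinator U P) (n : ℕ) (c : ℝ) :
    mgf (U n) P c = mgf (U 1) P c ^ n := by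
  have hsum : U n =ᵐ[P] ∑ i ∈ Finset.range n, fun ω => U (i + 1 : ℕ) ω - U i ω := by
    filter_upwards [hU.ae_sum_increment] with ω hω
    rw [Finset.sum_apply, hω]
  rw [mgf_congr hsum, (hU.indep.nat Nat.mono_cast).mgf_sum fun i =>
    (hU.measurable _).sub (hU.measurable _)]
  simp_rw [mgf_congr_identDistrib (hU.identDistrib_increment _)]
  rw [Finset.prod_const, Finset.card_range]

lemma ae_tendsto_natCast_div (hU : IsSubordinator U P) (hint : Integrable (U 1) P) :
    ∀ᵐ ω ∂P, Tendsto (fun n : ℕ => U n ω / n) atTop (𝓝 (∫ ω, U 1 ω ∂P)) := by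
  have hident := hU.identDistrib_increment
  have hslln := strong_law_ae_real (fun n ω => U (n + 1 : ℕ) ω - U n ω)
    ((hident 0).integrable_iff.2 hint)
    (fun i j hij => (hU.indep.nat Nat.mono_cast).indepFun hij)
    fun n => (hident n).trans (hident 0).symm
  rw [(hident 0).integral_eq] at hslln
  filter_upwards [hslln, hU.ae_sum_increment] with ω hlim hsum
  simpa only [hsum] using hlim

lemma ae_tendsto_div (hU : IsSubordinator U P) (hint : Integrable (U 1) P) :
    ∀ᵐ ω ∂P, Tendsto (fun t : ℝ≥0 => U t ω / t) atTop (𝓝 (∫ ω, U 1 ω ∂P)) := by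
  filter_upwards [hU.monotone, hU.ae_tendsto_natCast_div hint] with ω hmono hlim
  exact tendsto_div_atTop_of_monotone_of_nat hmono hlim

lemma integral_one_pos (hU : IsSubordinator U P) (hint : Integrable (U 1) P)
    (hne : ¬ U 1 =ᵐ[P] 0) : 0 < ∫ ω, U 1 ω ∂P :=
  (integral_nonneg_of_ae (hU.nonneg 1)).lt_of_ne'
    fun h => hne ((integral_eq_zero_iff_of_nonneg_ae (hU.nonneg 1) hint).1 h)

lemma exists_firstExit_le [IsProbabilityMeasure P] (hU : IsSubordinator U P)
    (hne : ¬ U 1 =ᵐ[P] 0) :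
    ∃ D : Ω → ℝ, MemLp D 2 P ∧ ∀ᵐ ω ∂P, ∀ t : ℝ≥0, firstExit U t ω ≤ (1 + t) * D ω := by
  have hlt : mgf (U 1) P (-2) < 1 :=
    mgf_lt_one_of_nonneg (hU.measurable 1).aemeasurable (hU.nonneg 1) hne (by norm_num)
  have hexp (n : ℕ) : Integrable (fun ω => Real.exp (-2 * U n ω)) P :=
    integrable_exp_mul_of_nonpos_of_nonneg (hU.measurable n).aemeasurable (hU.nonneg n)
      (by norm_num)
  obtain ⟨δ, hδ, W, hW, hW0, hle⟩ :=
    exists_memLp_two_forall_mul_le_add hlt hexp fun n => (hU.mgf_natCast n _).le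
  have hD : MemLp (fun ω => 1 + δ⁻¹ * (1 + W ω)) 2 P :=
    (memLp_const (1 : ℝ)).add (((memLp_const (1 : ℝ)).add hW).const_mul δ⁻¹)
  refine ⟨fun ω => 1 + δ⁻¹ * (1 + W ω), hD, ?_⟩
  filter_upwards [hle] with ω hω t
  have ht : (0 : ℝ) ≤ t := t.2
  have hWω : 0 ≤ W ω := hW0 ω
  calc (firstExit U t ω : ℝ) ≤ 1 + (t + W ω) / δ := exitTime_le_of_forall_mul_le_add hδ hWω hω t
    _ ≤ (1 + t) * (1 + δ⁻¹ * (1 + W ω)) := by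
      rw [div_eq_inv_mul]
      nlinarith [mul_nonneg (inv_pos.2 hδ).le (mul_nonneg ht hWω), inv_pos.2 hδ]

lemma exists_measurable_firstExit (hU : IsSubordinator U P) :
    ∃ V : (ℝ≥0 → ℝ) → ℝ≥0 → ℝ≥0, Measurable V ∧
      (fun ω => V fun t => U t ω) =ᵐ[P] fun ω t => firstExit U t ω := by
  obtain ⟨V, hV, hVexit⟩ := exists_measurable_exitTime
  refine ⟨V, hV, ?_⟩
  filter_upwards [hU.rightContinuous] with ω hω using hVexit _ hω

lemma hasLinearGrowth_firstExit [IsProbabilityMeasure P] (hU : IsSubordinator U P)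
    (hint : Integrable (U 1) P) (hne : ¬ U 1 =ᵐ[P] 0) :
    HasLinearGrowth (firstExit U) (∫ ω, U 1 ω ∂P)⁻¹ P := by
  have hm := hU.integral_one_pos hint hne
  have hlim := hU.ae_tendsto_div hint
  obtain ⟨V, hV, hVfirst⟩ := hU.exists_measurable_firstExit
  refine ⟨fun t => ?_, ?_, fun t ht => ?_, inv_pos.2 hm, ?_, hU.exists_firstExit_le hne⟩
  · exact ⟨_, (measurable_pi_apply t).comp (hV.comp hU.measurable_path),
      hVfirst.symm.fun_comp (Function.eval t)⟩
  · filter_upwards [hlim] with ω hω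
    exact monotone_exitTime (tendsto_atTop_of_tendsto_div hm hω)
  · filter_upwards [hlim, hU.rightContinuous, hU.zero] with ω hω hright h0
    exact exitTime_pos (tendsto_atTop_of_tendsto_div hm hω) hright h0 ht
  · filter_upwards [hlim, hU.monotone] with ω hω hmono
    exact tendsto_exitTime_div hmono hm hω

lemma indepFun_firstExit {E : Type*} [MeasurableSpace E] {X : Ω → E} (hU : IsSubordinator U P)
    (hXU : IndepFun X (fun ω t => U t ω) P) : IndepFun X (fun ω t => firstExit U t ω) P := by
  obtain ⟨V, hV, hVfirst⟩ := hU.exists_measurable_firstExit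
  exact (hXU.comp measurable_id hV).congr .rfl hVfirst

end IsSubordinator

end Subordinator

section Gamma

lemma ae_gammaMeasure_pos (a r : ℝ) : ∀ᵐ x ∂gammaMeasure a r, 0 < x := by
  have hIic : gammaMeasure a r (Set.Iic 0) = 0 := by
    rw [gammaMeasure, withDensity_apply _ measurableSet_Iic, setLIntegral_congr Iio_ae_eq_Iic.symm]
    exact lintegral_gammaPDF_of_nonpos le_rfl
  filter_upwards [measure_eq_zero_iff_ae_notMem.1 hIic] with x hx using not_le.1 hx

lemma measurable_gammaPDF (a r : ℝ) : Measurable (gammaPDF a r) :=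
  (measurable_gammaPDFReal a r).ennreal_ofReal

lemma gammaPDF_mul_enorm {a r : ℝ} (ha : 0 < a) (hr : 0 < r) (x : ℝ) :
    gammaPDF a r x * ‖x‖ₑ = ENNReal.ofReal (a / r) * gammaPDF (a + 1) r x := by
  rcases lt_trichotomy x 0 with hx | rfl | hx
  · simp [gammaPDF_of_neg hx]
  · simp [gammaPDF_of_nonneg, Real.zero_rpow ha.ne']
  · rw [gammaPDF_of_nonneg hx.le, gammaPDF_of_nonneg hx.le, Real.enorm_eq_ofReal hx.le,
      ← ENNReal.ofReal_mul (by positivity), ← ENNReal.ofReal_mul (by positivity),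
      Real.Gamma_add_one ha.ne', add_sub_cancel_right, Real.rpow_add_one hr.ne',
      Real.rpow_sub_one hx.ne']
    congr 1
    field_simp

lemma integrable_id_gammaMeasure {a r : ℝ} (ha : 0 < a) (hr : 0 < r) :
    Integrable id (gammaMeasure a r) := by
  refine ⟨aestronglyMeasurable_id, ?_⟩
  rw [hasFiniteIntegral_iff_enorm, gammaMeasure,
    lintegral_withDensity_eq_lintegral_mul _ (measurable_gammaPDF a r) (by fun_prop)]
  simp_rw [Pi.mul_apply, id, gammaPDF_mul_enorm ha hr]
  rw [lintegral_const_mul _ (measurable_gammaPDF _ _), lintegral_gammaPDF_eq_one (by positivity) hr,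
    mul_one]
  exact ENNReal.ofReal_lt_top

end Gamma

namespace IsGammaProcess

variable {Ω : Type*} [MeasurableSpace Ω] {P : Measure Ω} {ν : ℝ} {U : ℝ≥0 → Ω → ℝ}

lemma ae_lt (hU : IsGammaProcess ν U P) {s t : ℝ≥0} (hst : s < t) : ∀ᵐ ω ∂P, U s ω < U t ω := by
  have hlaw := hU.law s (t - s) (tsub_pos_of_lt hst)
  filter_upwards [(hlaw.ae_iff (by fun_prop)).2 (ae_gammaMeasure_pos _ _)] with ω hω
  simpa [add_tsub_cancel_of_le hst.le] using hω

lemma ae_isRightContinuous (hU : IsGammaProcess ν U P) :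
    ∀ᵐ ω ∂P, IsRightContinuous fun t => U t ω := by
  filter_upwards [hU.cadlag] with ω hω t using (hω t).1

lemma ae_monotone (hU : IsGammaProcess ν U P) : ∀ᵐ ω ∂P, Monotone fun t => U t ω := by
  obtain ⟨s, hs, hsd⟩ := TopologicalSpace.exists_countable_dense ℝ≥0
  have hmono : ∀ᵐ ω ∂P, ∀ p ∈ s, ∀ q ∈ s, p < q → U p ω < U q ω := by
    simp_rw [ae_ball_iff hs, eventually_imp_distrib_left]
    exact fun p _ q _ hpq => hU.ae_lt hpq
  filter_upwards [hmono, hU.ae_isRightContinuous] with ω hω hright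
  exact hright.monotone_of_monotoneOn_dense hsd
    (StrictMonoOn.monotoneOn fun p hp q hq hpq => hω p hp q hq hpq)

lemma hasLaw (hU : IsGammaProcess ν U P) {t : ℝ≥0} (ht : 0 < t) :
    HasLaw (U t) (gammaMeasure (t / ν) 1) P := by
  refine (hU.law 0 t ht).congr ?_
  filter_upwards [hU.zero] with ω h0
  rw [zero_add, h0, sub_zero]

lemma isSubordinator (hU : IsGammaProcess ν U P) : IsSubordinator U P where
  measurable := hU.measurable
  zero := hU.zero
  indep := hU.indep
  identDistrib t h := by
    rcases eq_zero_or_pos h with rfl | hh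
    · refine IdentDistrib.of_ae_eq ((hU.measurable _).sub (hU.measurable _)).aemeasurable ?_
      filter_upwards [hU.zero] with ω h0
      rw [add_zero, sub_self, h0]
    · exact (hU.law t h hh).identDistrib (hU.hasLaw hh)
  monotone := hU.ae_monotone
  rightContinuous := hU.ae_isRightContinuous

lemma integrable (hU : IsGammaProcess ν U P) (hν : 0 < ν) {t : ℝ≥0} (ht : 0 < t) :
    Integrable (U t) P := by
  have hlaw := hU.hasLaw ht
  refine (integrable_map_measure aestronglyMeasurable_id hlaw.aemeasurable).1 ?_
  rw [hlaw.map_eq]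
  exact integrable_id_gammaMeasure (div_pos ht hν) one_pos

lemma not_ae_eq_zero [NeZero P] (hU : IsGammaProcess ν U P) {t : ℝ≥0} (ht : 0 < t) :
    ¬ U t =ᵐ[P] 0 := fun h => by
  obtain ⟨ω, hω, h0, hpos⟩ := (h.and (hU.zero.and (hU.ae_lt ht))).exists
  exact hpos.ne (h0.trans hω.symm)

end IsGammaProcess

theorem mainTheorem1_general {Ω : Type*} [MeasurableSpace Ω] (P : Measure Ω)
    [IsProbabilityMeasure P] (H : ℝ) (hH : H ∈ Set.Ioo (0 : ℝ) 1) (B U : ℝ≥0 → Ω → ℝ)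
    (hB : IsFractionalProcess H B P) (hU : IsSubordinator U P) (hint : Integrable (U 1) P)
    (hne : ¬ U 1 =ᵐ[P] 0) (hBU : IndepFun (fun ω t => B t ω) (fun ω t => U t ω) P) :
    HasLRD (timeChange B (firstExit U)) P :=
  hB.hasLRD_timeChange (hU.hasLinearGrowth_firstExit hint hne) (hU.indepFun_firstExit hBU) hH

theorem mainTheorem1 {Ω : Type*} [MeasurableSpace Ω] (P : Measure Ω) [IsProbabilityMeasure P]
    (H ν : ℝ) (hH : H ∈ Set.Ioo (0 : ℝ) 1) (hν : 0 < ν)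
    (B U : ℝ≥0 → Ω → ℝ) (hB : IsFBM H B P) (hU : IsGammaProcess ν U P)
    (hBU : IndepFun (fun ω t => B t ω) (fun ω t => U t ω) P) :
    HasLRD (timeChange B (firstExit U)) P :=
  mainTheorem1_general P H hH B U hB.isFractionalProcess hU.isSubordinator
    (hU.integrable hν one_pos) (hU.not_ae_eq_zero one_pos) hBU
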